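/- **Theorem 4.1 (Analyticity of Perturbation).** Let $\mathfrak D=\{z\in\mathbb C:|z|<1\}$, $\mathbb T=\mathbb R/\mathbb Z$ with its Lebesgue (Haar) probability measure $m$, and $\chi(x)=e^{2\pi i x}$. An *inner function* is an analytic map $\phi:\mathfrak D\to\mathfrak D$ whose radial limit $\phi(\chi(x)):=\lim_{r\to1-}\phi(r\chi(x))$ exists and has modulus $1$ for $m$-a.e. $x\in\mathbb T$. Its *restriction* $\tau:\mathbb T\to\mathbb T$ is defined $m$-a.e. by $\chi(\tau x)=\phi(\chi(x))$. The *transfer operator* $\hat\tau:L^1(m)\to L^1(m)$ is defined by $\int_A\hat\tau f\,dm=\int_{\tau^{-1}A}f\,dm$ for all Borel sets $A\subseteq\mathbb T$. For $b>1$ let $$k_b:=\Big\{u\in L^2(m):\ \|u\|_{k_b}^2:=\sum_{n\in\mathbb Z}b^{|n|}|\hat u(n)|^2<\infty\Big\},\qquad \hat u(n)=\int_{\mathbb T}u\,\chi^{-n}\,dm,$$ equipped with the norm $\|\cdot\|_{k_b}$. Let $\phi$ be an inner function which is not a Möbius transformation, with $\phi(0)=0$ and restriction $\tau$; let $B>1$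 and let $\psi\in k_B$ (complex valued). Let $1<b<B$. Then: 1. For every $z\in\mathbb C$ and $f\in k_b$, the function $e^{z\psi}f$ is integrable, $\Pi_zf:=\hat\tau(e^{z\psi}f)$ belongs to $k_b$, and $\Pi_z$ is a bounded linear operator on $k_b$. 2. The map $z\mapsto\Pi_z$ from $\mathbb C$ to the space of bounded linear operators on $k_b$, with the operator norm, is entire (complex differentiable at every point). 3. For every $n\ge0$, $z\in\mathbb C$ and $f\in k_b$, one has $\psi^nf\in k_b$ and $$\Big(\frac{d^n\Pi_z}{dz^n}\Big)(f)=\Pi_z(\psi^nf).$$ -/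

import Mathlib

open MeasureTheory Filter Topology

/-- The character `χ x = exp (2 π i x)` identifying `ℝ/ℤ` with the unit circle. -/
noncomputable def circleChar (x : UnitAddCircle) : ℂ := (AddCircle.toCircle x : ℂ)

/-- `φ` restricts to an inner function of the open unit disc: an analytic self-map of the disc,
having radial limits of modulus one at Lebesgue-a.e. boundary point. Only the values of `φ` in the
open disc matter. -/
structure IsInner (φ : ℂ → ℂ) : Prop where
  differentiableOn : DifferentiableOn ℂ φ (Metric.ball 0 1)
  mapsTo : Set.MapsTo φ (Metric.ball 0 1) (Metric.ball 0 1)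
  radialLimit : ∀ᵐ x ∂(AddCircle.haarAddCircle : Measure UnitAddCircle),
    ∃ w : ℂ, ‖w‖ = 1 ∧ Tendsto (fun r : ℝ => φ (r * circleChar x)) (𝓝[<] 1) (𝓝 w)

/-- `φ` coincides in the unit disc with a fractional linear transformation. -/
def IsMoebius (φ : ℂ → ℂ) : Prop :=
  ∃ a b c d : ℂ, a * d - b * c ≠ 0 ∧
    ∀ z ∈ Metric.ball (0 : ℂ) 1, c * z + d ≠ 0 ∧ φ z = (a * z + b) / (c * z + d)

open Classical in
/-- The restriction `τ` of `φ` to `ℝ/ℤ`: `χ (τ x)` is the radial limit of `φ` at `χ x`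
(with the value `0` where there is no unimodular radial limit, a null set if `φ` is inner). -/
noncomputable def restriction (φ : ℂ → ℂ) (x : UnitAddCircle) : UnitAddCircle :=
  if h : ∃ y : UnitAddCircle,
      Tendsto (fun r : ℝ => φ (r * circleChar x)) (𝓝[<] 1) (𝓝 (circleChar y))
  then h.choose else 0

theorem IsInner.tendsto_restriction {φ : ℂ → ℂ} (hφ : IsInner φ) :
    ∀ᵐ x ∂(AddCircle.haarAddCircle : Measure UnitAddCircle),
      Tendsto (fun r : ℝ => φ (r * circleChar x)) (𝓝[<] 1) (𝓝 (circleChar (restriction φ x))) := by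
  filter_upwards [hφ.radialLimit] with x hx
  obtain ⟨w, hw, ht⟩ := hx
  have h : ∃ y : UnitAddCircle,
      Tendsto (fun r : ℝ => φ (r * circleChar x)) (𝓝[<] 1) (𝓝 (circleChar y)) := by
    obtain ⟨y, hy⟩ := (AddCircle.homeomorphCircle (T := 1) one_ne_zero).surjective
      ⟨w, mem_sphere_zero_iff_norm.2 hw⟩
    refine ⟨y, ?_⟩
    have : circleChar y = w := by
      rw [AddCircle.homeomorphCircle_apply] at hy
      simp [circleChar, hy]
    rwa [this]
  unfold restriction
  rw [dif_pos h]
  exact h.choose_spec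

/-- `g = T̂ f`, where `T̂` is the transfer operator on `L¹(m)` of the transformation `T`, that is
`∫_A g dm = ∫_{T⁻¹ A} f dm` for all measurable `A`. -/
structure IsTransfer {X : Type*} [MeasurableSpace X] (m : Measure X) (T : X → X) (f g : X → ℂ) :
    Prop where
  integrable : Integrable f m
  integrable_transfer : Integrable g m
  setIntegral_eq : ∀ A : Set X, MeasurableSet A → ∫ x in A, g x ∂m = ∫ x in T ⁻¹' A, f x ∂m

/-- Membership of a function in `k_b`: `u ∈ L²` and `∑ b ^ |n| * |û(n)|² < ∞`. -/
def MemK (b : ℝ) (u : UnitAddCircle → ℂ) : Prop :=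
  MemLp u 2 (AddCircle.haarAddCircle : Measure UnitAddCircle) ∧
    Summable fun n : ℤ => b ^ n.natAbs * ‖fourierCoeff u n‖ ^ 2

theorem norm_weight_mul_sq {b : ℝ} (hb : 1 < b) (k : ℕ) (c : ℂ) :
    ‖(√b ^ k : ℂ) * c‖ ^ 2 = b ^ k * ‖c‖ ^ 2 := by
  rw [norm_mul, mul_pow, norm_pow, ← pow_mul, mul_comm k 2, pow_mul, Complex.norm_real,
    Real.norm_of_nonneg (Real.sqrt_nonneg b), Real.sq_sqrt (by linarith)]

theorem memK_iff_memℓp {b : ℝ} (hb : 1 < b)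
    (u : Lp ℂ 2 (AddCircle.haarAddCircle : Measure UnitAddCircle)) :
    MemK b u ↔ Memℓp (fun n : ℤ => (√b ^ n.natAbs : ℂ) * fourierBasis.repr u n) 2 := by
  have h2 : (2 : ENNReal).toReal = 2 := by norm_num
  rw [memℓp_gen_iff (by norm_num), h2, MemK, and_iff_right (Lp.memLp u)]
  refine summable_congr fun n => ?_
  rw [fourierBasis_repr, Real.rpow_ofNat, norm_weight_mul_sq hb]

/-- `k_b` as a linear subspace of `L²`. -/
noncomputable def kSubmodule (b : ℝ) [hb : Fact (1 < b)] :
    Submodule ℂ (Lp ℂ 2 (AddCircle.haarAddCircle : Measure UnitAddCircle)) where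
  carrier := {u | MemK b u}
  zero_mem' := by
    rw [Set.mem_ofPred_eq, memK_iff_memℓp hb.out]
    convert zero_memℓp (E := fun _ : ℤ => ℂ) (p := 2) using 2 with n
    simp
  add_mem' {u v} hu hv := by
    rw [Set.mem_ofPred_eq, memK_iff_memℓp hb.out] at *
    convert hu.add hv using 2 with n
    simp [mul_add]
  smul_mem' c u hu := by
    rw [Set.mem_ofPred_eq, memK_iff_memℓp hb.out] at *
    convert hu.const_smul c using 2 with n
    simp [mul_left_comm]

/-- The space `k_b`, which carries its own norm `‖u‖² = ∑ b ^ |n| * |û(n)|²`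
(see `KSpace.norm_sq`), not the norm of `L²`. -/
def KSpace (b : ℝ) [Fact (1 < b)] : Type := ↥(kSubmodule b)

namespace KSpace

variable {b : ℝ} [hb : Fact (1 < b)]

noncomputable instance : AddCommGroup (KSpace b) := inferInstanceAs (AddCommGroup (kSubmodule b))

noncomputable instance : Module ℂ (KSpace b) := inferInstanceAs (Module ℂ (kSubmodule b))

/-- The inclusion of `k_b` in `L²`. -/
noncomputable def toL2 :
    KSpace b →ₗ[ℂ] Lp ℂ 2 (AddCircle.haarAddCircle : Measure UnitAddCircle) :=
  (kSubmodule b).subtype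

theorem toL2_injective : Function.Injective (toL2 (b := b)) := Subtype.val_injective

theorem memK (u : KSpace b) : MemK b (toL2 u) := u.2

/-- The weighted Fourier coefficients `b ^ (|n| / 2) * û(n)`, as an element of `ℓ²(ℤ)`. -/
noncomputable def weighted : KSpace b →ₗ[ℂ] lp (fun _ : ℤ => ℂ) 2 where
  toFun u := ⟨fun n : ℤ => (√b ^ n.natAbs : ℂ) * fourierBasis.repr (toL2 u) n,
    (memK_iff_memℓp hb.out _).1 (memK u)⟩
  map_add' u v := by
    ext n
    rw [lp.coeFn_add]
    simp [mul_add]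
  map_smul' c u := by
    ext n
    simp [mul_left_comm]

theorem weighted_injective : Function.Injective (weighted (b := b)) := by
  intro u v h
  apply toL2_injective
  apply fourierBasis.repr.injective
  ext n
  have hn : (√b ^ n.natAbs : ℂ) * fourierBasis.repr (toL2 u) n =
      (√b ^ n.natAbs : ℂ) * fourierBasis.repr (toL2 v) n :=
    congrFun (congrArg Subtype.val h) n
  have hb0 : (√b : ℂ) ≠ 0 := by
    have : 0 < √b := Real.sqrt_pos.2 (lt_trans one_pos hb.out)
    exact_mod_cast this.ne'
  exact mul_left_cancel₀ (pow_ne_zero _ hb0) hn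

noncomputable instance : NormedAddCommGroup (KSpace b) :=
  NormedAddCommGroup.induced (KSpace b) (lp (fun _ : ℤ => ℂ) 2) weighted weighted_injective

noncomputable instance : NormedSpace ℂ (KSpace b) :=
  NormedSpace.induced ℂ (KSpace b) (lp (fun _ : ℤ => ℂ) 2) weighted

theorem norm_sq (u : KSpace b) :
    ‖u‖ ^ 2 = ∑' n : ℤ, b ^ n.natAbs * ‖fourierCoeff (toL2 u) n‖ ^ 2 := by
  have h2 : (2 : ENNReal).toReal = 2 := by norm_num
  have h := lp.norm_rpow_eq_tsum (E := fun _ : ℤ => ℂ) (p := 2) (by norm_num) (weighted u)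
  rw [h2, Real.rpow_ofNat] at h
  change ‖weighted u‖ ^ 2 = _
  rw [h]
  refine tsum_congr fun n => ?_
  change ‖(√b ^ n.natAbs : ℂ) * fourierBasis.repr (toL2 u) n‖ ^ (2 : ℝ) = _
  rw [fourierBasis_repr, Real.rpow_ofNat, norm_weight_mul_sq hb.out]

end KSpace

-- Write `Π_z = T ∘ exp(zM)`, where `T` is the transfer operator and `M` is multiplication by `ψ`.
-- Once both are known to be bounded on the Banach space `k_b`, `z ↦ T exp(zM)` is entire and each
-- derivative contributes a factor `M` on the right.
--
-- Both bounds come from one criterion (`KSpace.exists_clm_of_convolution_bound`): conjugate the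
-- Fourier matrix by the weights `√b ^ |n|`; if the result is dominated by `w (n - k)` with `w` in
-- `ℓ¹`, Young's inequality gives boundedness on `ℓ²`, hence on `k_b`.
--
-- For `T`: since `φ(0) = 0`, `φ ^ n` vanishes to order `n` at the origin. This makes `τ` preserve
-- `m`, so that `T` is the adjoint of composition with `τ`, and it kills the entry `(n, k)` unless
-- `n` lies between `0` and `k`. There `|k| = |n| + |n - k|`, so the weights yield the kernel `√b ^
-- (-|n - k|)`.
--
-- For `M`: the entry is `ψ̂(n - k)`, and `√b ^ |n| ≤ √b ^ |n - k| * √b ^ |k|` yields the kernel `√b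
-- ^ |j| * |ψ̂(j)|`, summable because `b < B`.
--
-- Finally the operator `exp(zM)` is identified with multiplication by `e^{zψ}`.

local notation "m" => (AddCircle.haarAddCircle : Measure UnitAddCircle)
local notation "L2" => Lp ℂ 2 (AddCircle.haarAddCircle : Measure UnitAddCircle)

/-- Young's inequality `ℓ¹ * ℓ² ⊆ ℓ²` on a commutative group, squared. -/
theorem ENNReal.tsum_sq_tsum_mul_le {G : Type*} [AddCommGroup G] (w x : G → ENNReal) :
    ∑' n, (∑' k, w (n - k) * x k) ^ 2 ≤ (∑' n, w n) ^ 2 * ∑' k, x k ^ 2 := by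
  have hw (n : G) : ∑' k, w (n - k) = ∑' k, w k := (Equiv.subLeft n).tsum_eq w
  have hw' (k : G) : ∑' n, w (n - k) = ∑' n, w n := (Equiv.subRight k).tsum_eq w
  -- With the discrete σ-algebra, sums are integrals against counting measure. Cauchy–Schwarz is
  -- applied to the splitting `w x = w^{1/2} · (w^{1/2} x)`.
  let _ : MeasurableSpace G := ⊤
  have hcs (n : G) : (∑' k, w (n - k) * x k) ^ 2 ≤
      (∑' k, w k) * ∑' k, w (n - k) * x k ^ 2 := by
    have h := ENNReal.lintegral_mul_le_Lp_mul_Lq (Measure.count : Measure G)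
      (Real.holderConjugate_iff.2 ⟨by norm_num, by norm_num⟩ : Real.HolderConjugate 2 2)
      (f := fun k => w (n - k) ^ (1 / 2 : ℝ)) (g := fun k => w (n - k) ^ (1 / 2 : ℝ) * x k)
      measurable_from_top.aemeasurable measurable_from_top.aemeasurable
    simp only [lintegral_count, Pi.mul_apply] at h
    have h1 (y : ENNReal) : (y ^ (1 / 2 : ℝ)) ^ 2 = y := by
      rw [← ENNReal.rpow_natCast, ← ENNReal.rpow_mul]; norm_num
    have h2 (y : ENNReal) : y ^ (1 / 2 : ℝ) * y ^ (1 / 2 : ℝ) = y := by rw [← sq, h1]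
    calc (∑' k, w (n - k) * x k) ^ 2
        = (∑' k, w (n - k) ^ (1 / 2 : ℝ) * (w (n - k) ^ (1 / 2 : ℝ) * x k)) ^ 2 := by
          simp only [← mul_assoc, h2]
      _ ≤ _ := pow_le_pow_left' h 2
      _ = _ := by
          simp only [ENNReal.rpow_two, mul_pow, h1, hw]
  calc _ ≤ ∑' n, (∑' k, w k) * ∑' k, w (n - k) * x k ^ 2 := ENNReal.tsum_le_tsum hcs
    _ = (∑' k, w k) * ∑' k, ∑' n, w (n - k) * x k ^ 2 := by
        rw [ENNReal.tsum_mul_left, ENNReal.tsum_comm]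
    _ = _ := by
        simp only [ENNReal.tsum_mul_right, hw', ENNReal.tsum_mul_left]
        rw [← mul_assoc, sq]


/-! ### The space `k_b` as a weighted `ℓ²`, and a boundedness criterion -/

namespace KSpace

variable {b : ℝ} [hb : Fact (1 < b)]

theorem sqrt_base_pos (b : ℝ) [hb : Fact (1 < b)] : 0 < √b := Real.sqrt_pos.2 (lt_trans one_pos hb.out)

theorem one_lt_sqrt (b : ℝ) [hb : Fact (1 < b)] : 1 < √b :=
  Real.lt_sqrt_of_sq_lt (by simpa using hb.out)

theorem weighted_apply (u : KSpace b) (n : ℤ) :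
    weighted u n = (√b ^ n.natAbs : ℂ) * fourierBasis.repr (toL2 u) n := rfl

theorem norm_weighted (u : KSpace b) : ‖weighted u‖ = ‖u‖ := rfl

theorem weighted_surjective : Function.Surjective (weighted (b := b)) := by
  intro c
  have hb0 : (√b : ℂ) ≠ 0 := by exact_mod_cast (sqrt_base_pos b).ne'
  have hd : Memℓp (fun n : ℤ => (√b ^ n.natAbs : ℂ)⁻¹ * c n) 2 := by
    refine (lp.memℓp c).mono' fun n => ?_
    rw [norm_mul, norm_inv, norm_pow, Complex.norm_real, Real.norm_of_nonneg (Real.sqrt_nonneg b)]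
    exact mul_le_of_le_one_left (norm_nonneg _)
      (inv_le_one_of_one_le₀ (one_le_pow₀ (one_lt_sqrt b).le))
  have hu (n : ℤ) : (√b ^ n.natAbs : ℂ) *
      fourierBasis.repr (fourierBasis.repr.symm ⟨_, hd⟩ : L2) n = c n := by
    rw [LinearIsometryEquiv.apply_symm_apply]
    exact mul_inv_cancel_left₀ (pow_ne_zero _ hb0) _
  have hm : MemK b (fourierBasis.repr.symm ⟨_, hd⟩ : L2) := by
    rw [memK_iff_memℓp hb.out]
    simp only [hu]
    exact lp.memℓp c
  exact ⟨(⟨_, hm⟩ : kSubmodule b), lp.ext (funext hu)⟩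

/-- `k_b` is isometrically isomorphic to `ℓ²(ℤ)`. -/
noncomputable def weightedEquiv : KSpace b ≃ₗᵢ[ℂ] lp (fun _ : ℤ => ℂ) 2 where
  toLinearEquiv := LinearEquiv.ofBijective weighted ⟨weighted_injective, weighted_surjective⟩
  norm_map' _ := rfl

/-- Completeness makes the exponential series of a bounded operator on `k_b` converge. -/
noncomputable instance : CompleteSpace (KSpace b) :=
  (weightedEquiv (b := b)).toIsometryEquiv.completeSpace

theorem enorm_sq (u : KSpace b) : ‖u‖ₑ ^ 2 = ∑' n, ‖weighted u n‖ₑ ^ 2 := by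
  have h := lp.hasSum_norm (E := fun _ : ℤ => ℂ) (p := 2) (by norm_num) (weighted u)
  simp only [ENNReal.toReal_ofNat, Real.rpow_ofNat, norm_weighted] at h
  have h' := ENNReal.ofReal_tsum_of_nonneg (fun n => by positivity) h.summable
  rw [h.tsum_eq, ENNReal.ofReal_pow (norm_nonneg _), ofReal_norm] at h'
  rw [h']
  exact tsum_congr fun n => by rw [ENNReal.ofReal_pow (norm_nonneg _), ofReal_norm]

theorem norm_toL2_le (u : KSpace b) : ‖toL2 u‖ ≤ ‖u‖ := by
  rw [← (fourierBasis (T := 1)).repr.norm_map, ← norm_weighted]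
  refine lp.norm_mono (by norm_num) fun n => ?_
  rw [weighted_apply, norm_mul, norm_pow, Complex.norm_real,
    Real.norm_of_nonneg (Real.sqrt_nonneg b)]
  exact le_mul_of_one_le_left (norm_nonneg _) (one_le_pow₀ (one_lt_sqrt b).le)

theorem continuous_toL2 : Continuous (toL2 (b := b)) :=
  (toL2.mkContinuous 1 fun u => by simpa using norm_toL2_le u).continuous

theorem memK_of_tsum_enorm_sq_ne_top {u : L2}
    (h : ∑' n : ℤ, ‖(√b ^ n.natAbs : ℂ) * fourierBasis.repr u n‖ₑ ^ 2 ≠ ⊤) : MemK b u := by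
  rw [memK_iff_memℓp hb.out, memℓp_gen_iff (by norm_num)]
  have := ENNReal.summable_toReal h
  simpa using this

/-- A bounded operator on `L²` whose weighted Fourier matrix is dominated by an `ℓ¹` convolution
kernel restricts to a bounded operator on `k_b`. -/
theorem exists_clm_of_convolution_bound (S : L2 →L[ℂ] L2) {w : ℤ → ℝ} (hw : Summable w)
    (h : ∀ n k : ℤ, √b ^ n.natAbs * ‖fourierBasis.repr (S (fourierBasis k)) n‖ ≤
      w (n - k) * √b ^ k.natAbs) :
    ∃ R : KSpace b →L[ℂ] KSpace b, ∀ u, toL2 (R u) = S (toL2 u) := by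
  -- The weight at `k = 0` is `1`, so `h n 0` forces `w n ≥ 0`.
  have hw0 (n : ℤ) : 0 ≤ w n := by
    have := (by positivity : (0 : ℝ) ≤ _).trans (h n 0)
    simpa using this
  have hwt : ∑' n, ENNReal.ofReal (w n) ≠ ⊤ := hw.tsum_ofReal_ne_top
  have hsum (u : L2) (n : ℤ) : HasSum (fun k => fourierBasis.repr u k *
      fourierBasis.repr (S (fourierBasis k)) n) (fourierBasis.repr (S u) n) := by
    have := ((fourierBasis.hasSum_repr u).mapL S).mapL (innerSL ℂ (fourierBasis n))
    simpa only [map_smul, smul_eq_mul, innerSL_apply_apply, ← HilbertBasis.repr_apply_apply]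
      using this
  have hbound (u : KSpace b) (n : ℤ) :
      ‖(√b ^ n.natAbs : ℂ) * fourierBasis.repr (S (toL2 u)) n‖ₑ ≤
        ∑' k, ENNReal.ofReal (w (n - k)) * ‖weighted u k‖ₑ := by
    rw [← ((hsum (toL2 u) n).mul_left _).tsum_eq]
    refine enorm_tsum_le_tsum_enorm.trans (ENNReal.tsum_le_tsum fun k => ?_)
    rw [← ofReal_norm, ← ofReal_norm, ← ENNReal.ofReal_mul (hw0 _)]
    refine ENNReal.ofReal_le_ofReal ?_
    rw [weighted_apply]
    simp only [norm_mul, norm_pow, Complex.norm_real, Real.norm_of_nonneg (Real.sqrt_nonneg b)]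
    calc _ = (√b ^ n.natAbs * ‖fourierBasis.repr (S (fourierBasis k)) n‖) *
          ‖fourierBasis.repr (toL2 u) k‖ := by ring
      _ ≤ w (n - k) * √b ^ k.natAbs * ‖fourierBasis.repr (toL2 u) k‖ := by
          exact mul_le_mul_of_nonneg_right (h n k) (norm_nonneg _)
      _ = _ := by ring
  -- Computed in `ℝ≥0∞`, this single estimate gives both membership in `k_b` and the operator bound.
  have hle (u : KSpace b) :
      ∑' n : ℤ, ‖(√b ^ n.natAbs : ℂ) * fourierBasis.repr (S (toL2 u)) n‖ₑ ^ 2 ≤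
        (∑' n, ENNReal.ofReal (w n)) ^ 2 * ‖u‖ₑ ^ 2 := by
    rw [enorm_sq]
    exact (ENNReal.tsum_le_tsum fun n => pow_le_pow_left' (hbound u n) 2).trans
      (ENNReal.tsum_sq_tsum_mul_le (fun j => ENNReal.ofReal (w j)) _)
  have hmem (u : KSpace b) : S (toL2 u) ∈ kSubmodule b :=
    memK_of_tsum_enorm_sq_ne_top (ne_top_of_le_ne_top (by finiteness) (hle u))
  let R₀ : KSpace b →ₗ[ℂ] KSpace b := 
    LinearMap.codRestrict (kSubmodule b) (S.toLinearMap ∘ₗ toL2) hmem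
  refine ⟨R₀.mkContinuous (∑' n, ENNReal.ofReal (w n)).toReal fun u => ?_, fun u => rfl⟩
  have h2 : ‖R₀ u‖ₑ ≤ (∑' n, ENNReal.ofReal (w n)) * ‖u‖ₑ := by
    rw [← ENNReal.pow_le_pow_left_iff two_ne_zero, mul_pow, enorm_sq]
    exact hle u
  have h3 := ENNReal.toReal_mono (by finiteness) h2
  simpa using h3

end KSpace

/-! ### Boundary values of inner functions and invariance of `m` -/

theorem circleChar_continuous : Continuous circleChar := by
  unfold circleChar
  exact continuous_subtype_val.comp AddCircle.continuous_toCircle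

theorem norm_circleChar (x : UnitAddCircle) : ‖circleChar x‖ = 1 := Circle.norm_coe _

theorem circleChar_injective : Function.Injective circleChar :=
  Subtype.val_injective.comp (AddCircle.injective_toCircle one_ne_zero)

theorem circleChar_measurableEmbedding : MeasurableEmbedding circleChar :=
  (circleChar_continuous.isClosedEmbedding circleChar_injective).measurableEmbedding

theorem circleChar_ne_zero (x : UnitAddCircle) : circleChar x ≠ 0 :=
  norm_ne_zero_iff.1 (by simp [norm_circleChar])

theorem fourier_eq_circleChar_zpow (n : ℤ) (x : UnitAddCircle) :
    fourier n x = circleChar x ^ n := by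
  rw [fourier_apply, circleChar, AddCircle.toCircle_zsmul, Circle.coe_zpow]

theorem real_mul_circleChar_mem_ball {r : ℝ} (hr0 : 0 ≤ r) (hr : r < 1) (x : UnitAddCircle) :
    (r : ℂ) * circleChar x ∈ Metric.ball (0 : ℂ) 1 := by
  simpa [norm_circleChar, abs_of_nonneg hr0] using hr

/-- Mean value property on circles, for the parametrization by `ℝ/ℤ`. -/
theorem integral_comp_circleChar {h : ℂ → ℂ} (hd : DifferentiableOn ℂ h (Metric.ball 0 1))
    {r : ℝ} (hr0 : 0 ≤ r) (hr : r < 1) : ∫ x, h (r * circleChar x) ∂m = h 0 := by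
  have hc : DiffContOnCl ℂ h (Metric.ball 0 |r|) := by
    refine (hd.mono ?_).diffContOnCl
    rw [abs_of_nonneg hr0]
    exact (Metric.closure_ball_subset_closedBall).trans (Metric.closedBall_subset_ball hr)
  rw [← hc.circleAverage, Real.circleAverage_def, AddCircle.integral_haarAddCircle, inv_one,
    one_smul, ← UnitAddCircle.intervalIntegral_preimage 0]
  have := intervalIntegral.smul_integral_comp_mul_left (a := 0) (b := 1)
    (fun θ => h (circleMap 0 r θ)) (2 * Real.pi)
  rw [mul_zero, mul_one] at this
  rw [← this, inv_smul_smul₀ (by positivity), zero_add]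
  refine intervalIntegral.integral_congr fun a _ => ?_
  simp [circleChar, circleMap, AddCircle.toCircle_apply_mk, Circle.coe_exp]

namespace IsInner

variable {φ : ℂ → ℂ}

theorem continuous_comp_circleChar (hφ : IsInner φ) {r : ℝ} (hr0 : 0 ≤ r) (hr : r < 1) :
    Continuous fun x => φ (r * circleChar x) :=
  hφ.differentiableOn.continuousOn.comp_continuous
    (continuous_const.mul circleChar_continuous) (real_mul_circleChar_mem_ball hr0 hr)

theorem eventually_mem_Ioo : ∀ᶠ r : ℝ in 𝓝[<] 1, 0 < r ∧ r < 1 := by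
  filter_upwards [Ioo_mem_nhdsLT (zero_lt_one : (0 : ℝ) < 1)] with r hr using hr

theorem aemeasurable_restriction (hφ : IsInner φ) : AEMeasurable (restriction φ) m := by
  have h1 : AEMeasurable (circleChar ∘ restriction φ) m := by
    obtain ⟨u, -, hu1, hu⟩ := exists_seq_strictMono_tendsto' (zero_lt_one : (0 : ℝ) < 1)
    refine aemeasurable_of_tendsto_metrizable_ae atTop
      (f := fun i x => φ ((u i : ℝ) * circleChar x))
      (fun i => (hφ.continuous_comp_circleChar (hu1 i).1.le (hu1 i).2).measurable.aemeasurable) ?_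
    filter_upwards [hφ.tendsto_restriction] with x hx
    exact hx.comp (tendsto_nhdsWithin_iff.2 ⟨hu, .of_forall fun i => (hu1 i).2⟩)
  exact circleChar_measurableEmbedding.aemeasurable_comp_iff.1 h1

/-- The boundary function of `φ ^ n` has no Fourier coefficients of index less than `n`. -/
theorem integral_fourier_mul_fourier_restriction (hφ : IsInner φ) (hφ0 : φ 0 = 0) {n : ℕ} {k : ℤ}
    (hk : k < n) : ∫ x, fourier (-k) x * fourier n (restriction φ x) ∂m = 0 := by
  obtain ⟨j, hj⟩ : ∃ j : ℕ, (n : ℤ) = k + (j + 1) := by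
    obtain ⟨j, hj⟩ := Int.eq_ofNat_of_zero_le (sub_nonneg.2 (Int.add_one_le_iff.2 hk))
    exact ⟨j, by linarith⟩
  have hlim : Tendsto (fun r : ℝ => ∫ x, fourier (-k) x * φ (r * circleChar x) ^ n ∂m) (𝓝[<] 1)
      (𝓝 (∫ x, fourier (-k) x * fourier n (restriction φ x) ∂m)) := by
    refine tendsto_integral_filter_of_dominated_convergence (fun _ => 1) ?_ ?_
      (integrable_const 1) ?_
    · filter_upwards [eventually_mem_Ioo] with r hr
      exact ((map_continuous _).mul
        ((hφ.continuous_comp_circleChar hr.1.le hr.2).pow n)).aestronglyMeasurable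
    · filter_upwards [eventually_mem_Ioo] with r hr
      refine .of_forall fun x => ?_
      have := hφ.mapsTo (real_mul_circleChar_mem_ball hr.1.le hr.2 x)
      rw [mem_ball_zero_iff] at this
      rw [norm_mul, fourier_eq_circleChar_zpow, norm_zpow, norm_circleChar, one_zpow, one_mul,
        norm_pow]
      exact pow_le_one₀ (norm_nonneg _) this.le
    · filter_upwards [hφ.tendsto_restriction] with x hx
      rw [fourier_eq_circleChar_zpow n, zpow_natCast]
      exact (hx.pow n).const_mul _
  refine tendsto_nhds_unique hlim (tendsto_const_nhds.congr' ?_)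
  filter_upwards [eventually_mem_Ioo] with r hr
  -- Write `φ(z) = z g(z)` with `g = dslope φ 0`. As `n = k + (j + 1)`, on the circle of radius `r`
  -- the integrand is `r ^ k` times the analytic function `z ^ (j + 1) * g(z) ^ n`, which vanishes
  -- at `0`; so its mean is zero for every `r < 1`.
  have hd : DifferentiableOn ℂ (fun z => z ^ (j + 1) * dslope φ 0 z ^ n) (Metric.ball 0 1) :=
    (differentiableOn_id.pow _).mul
      (((Complex.differentiableOn_dslope (Metric.ball_mem_nhds 0 one_pos)).2
        hφ.differentiableOn).pow n)
  have hr0 : (r : ℂ) ≠ 0 := by exact_mod_cast hr.1.ne'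
  have h (x : UnitAddCircle) : fourier (-k) x * φ (r * circleChar x) ^ n = (r : ℂ) ^ k *
      ((r * circleChar x) ^ (j + 1) * dslope φ 0 (r * circleChar x) ^ n) := by
    have h0 := sub_smul_dslope φ 0 (r * circleChar x)
    rw [hφ0, sub_zero, sub_zero, smul_eq_mul] at h0
    have hx := circleChar_ne_zero x
    rw [← h0, fourier_eq_circleChar_zpow, mul_pow, ← zpow_natCast (r * circleChar x) n, hj,
      mul_zpow, mul_pow, zpow_add₀ hr0, zpow_add₀ hx, zpow_neg]
    field_simp
    norm_cast
    ring
  simp_rw [h]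
  rw [integral_const_mul, integral_comp_circleChar hd hr.1.le hr.2]
  simp

end IsInner

/-- A finite measure on the circle is determined by its Fourier coefficients. -/
theorem UnitAddCircle.measure_ext_of_integral_fourier {μ ν : Measure UnitAddCircle}
    [IsFiniteMeasure μ] [IsFiniteMeasure ν]
    (h : ∀ n : ℤ, ∫ x, fourier n x ∂μ = ∫ x, fourier n x ∂ν) : μ = ν := by
  refine ext_of_forall_mem_subalgebra_integral_eq_of_polish (𝕜 := ℂ)
    (A := fourierSubalgebra.comap (BoundedContinuousFunction.toContinuousMapStarₐ ℂ)) ?_ ?_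
  · intro x y hxy
    refine ⟨fourier 1, ⟨fourier 1, ⟨BoundedContinuousFunction.mkOfCompact (fourier 1), ?_, rfl⟩,
      rfl⟩, ?_⟩
    · exact Algebra.subset_adjoin ⟨1, rfl⟩
    · intro he
      simp only [fourier_one] at he
      exact hxy (AddCircle.injective_toCircle one_ne_zero (Subtype.val_injective he))
  · intro g hg
    have hg' : (g : C(UnitAddCircle, ℂ)) ∈ Submodule.span ℂ (Set.range (@fourier 1)) := by
      rw [← fourierSubalgebra_coe]; exact hg
    have hint (f : C(UnitAddCircle, ℂ)) (κ : Measure UnitAddCircle) [IsFiniteMeasure κ] :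
        Integrable f κ :=
      (map_continuous f).integrable_of_hasCompactSupport (HasCompactSupport.of_compactSpace _)
    change ∫ x, (g : C(UnitAddCircle, ℂ)) x ∂μ = ∫ x, (g : C(UnitAddCircle, ℂ)) x ∂ν
    generalize (g : C(UnitAddCircle, ℂ)) = f at hg' ⊢
    induction hg' using Submodule.span_induction with
    | mem f hf => obtain ⟨n, rfl⟩ := hf; exact h n
    | zero => simp
    | add f f' _ _ h1 h2 =>
      simp only [ContinuousMap.add_apply]
      rw [integral_add (hint f μ) (hint f' μ), integral_add (hint f ν) (hint f' ν), h1, h2]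
    | smul c f _ h1 =>
      simp only [ContinuousMap.smul_apply]
      rw [integral_smul, integral_smul, h1]

namespace IsInner

variable {φ : ℂ → ℂ}

/-- For `n > 0` this is the vanishing of `φ ^ n` at `0`; negative `n` follows by conjugation. -/
theorem integral_fourier_restriction (hφ : IsInner φ) (hφ0 : φ 0 = 0) (n : ℤ) :
    ∫ x, fourier n (restriction φ x) ∂m = ∫ x, fourier n x ∂m := by
  have hpos (n : ℕ) (hn : 0 < n) : ∫ x, fourier n (restriction φ x) ∂m = 0 := by
    simpa using hφ.integral_fourier_mul_fourier_restriction hφ0 (k := 0) (n := n) (by simpa)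
  have hid (n : ℤ) (hn : n ≠ 0) : ∫ x, fourier n x ∂m = 0 := by
    have := congrFun (fourierCoeff_fourier (T := 1) n) 0
    rw [fourierCoeff] at this
    simpa [hn.symm] using this
  obtain hn | rfl | hn := lt_trichotomy n 0
  · obtain ⟨k, rfl⟩ : ∃ k : ℕ, n = -k := ⟨n.natAbs, by omega⟩
    rw [hid _ hn.ne]
    simp_rw [fourier_neg]
    rw [integral_conj, hpos k (by omega), map_zero]
  · simp
  · lift n to ℕ using hn.le
    rw [hpos n (by simpa using hn), hid n hn.ne']

/-- The restriction, built by choice, is only known to be a.e. measurable, whereas composition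
operators need a measurable representative. -/
theorem exists_measurePreserving (hφ : IsInner φ) (hφ0 : φ 0 = 0) :
    ∃ τ : UnitAddCircle → UnitAddCircle, MeasurePreserving τ m m ∧ restriction φ =ᵐ[m] τ := by
  have hm := hφ.aemeasurable_restriction
  refine ⟨hm.mk, ⟨hm.measurable_mk, ?_⟩, hm.ae_eq_mk⟩
  have := Measure.isProbabilityMeasure_map (μ := m) hm
  rw [← Measure.map_congr hm.ae_eq_mk]
  refine UnitAddCircle.measure_ext_of_integral_fourier fun n => ?_
  rw [integral_map hm (map_continuous _).aestronglyMeasurable]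
  exact hφ.integral_fourier_restriction hφ0 n

end IsInner

/-! ### The transfer operator on `k_b` -/

/-- Summability of a geometric series over `ℤ`. -/
theorem summable_inv_pow_natAbs {q : ℝ} (hq : 1 < q) : Summable fun n : ℤ => (q ^ n.natAbs)⁻¹ := by
  have h : Summable fun n : ℕ => (q ^ n)⁻¹ := by
    simpa using summable_geometric_of_lt_one (by positivity) (inv_lt_one_of_one_lt₀ hq)
  exact Summable.of_nat_of_neg (by simpa using h) (by simpa using h)

/-- The adjoint of the composition operator with `τ` on `L²`. -/
noncomputable def transferL2 (τ : UnitAddCircle → UnitAddCircle) (hτ : MeasurePreserving τ m m) :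
    L2 →L[ℂ] L2 :=
  (Lp.compMeasurePreservingₗᵢ ℂ τ hτ).toContinuousLinearMap.adjoint

/-- The adjoint relation tested on indicators: composition with `τ` turns `1_A` into `1_{τ⁻¹A}`. -/
theorem setIntegral_transferL2 {τ : UnitAddCircle → UnitAddCircle} (hτ : MeasurePreserving τ m m)
    (f : L2) {A : Set UnitAddCircle} (hA : MeasurableSet A) :
    ∫ x in A, transferL2 τ hτ f x ∂m = ∫ x in τ ⁻¹' A, f x ∂m := by
  have h : Lp.compMeasurePreservingₗᵢ ℂ τ hτ (indicatorConstLp 2 hA (measure_ne_top m A) (1 : ℂ)) =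
      indicatorConstLp 2 (hτ.measurable hA) (measure_ne_top m _) (1 : ℂ) :=
    Lp.indicatorConstLp_compMeasurePreserving hA (measure_ne_top m A) 1 hτ
  rw [← L2.inner_indicatorConstLp_one hA (measure_ne_top m A), transferL2,
    ContinuousLinearMap.adjoint_inner_right]
  erw [h]
  rw [L2.inner_indicatorConstLp_one]

theorem repr_transferL2_fourierBasis {τ : UnitAddCircle → UnitAddCircle}
    (hτ : MeasurePreserving τ m m) (n k : ℤ) :
    fourierBasis.repr (transferL2 τ hτ (fourierBasis k)) n =
      ∫ x, fourier k x * fourier (-n) (τ x) ∂m := by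
  rw [HilbertBasis.repr_apply_apply, transferL2, ContinuousLinearMap.adjoint_inner_right,
    L2.inner_def]
  refine integral_congr_ae ?_
  have h1 : (Lp.compMeasurePreservingₗᵢ ℂ τ hτ (fourierBasis n) : L2) =ᵐ[m] fourier n ∘ τ := by
    rw [coe_fourierBasis]
    exact (Lp.coeFn_compMeasurePreserving _ hτ).trans
      (hτ.quasiMeasurePreserving.ae_eq_comp (coeFn_fourierLp 2 n))
  have h2 : (fourierBasis k : L2) =ᵐ[m] fourier k := by
    rw [coe_fourierBasis]; exact coeFn_fourierLp 2 k
  filter_upwards [h1, h2] with x hx1 hx2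
  change inner ℂ ((Lp.compMeasurePreservingₗᵢ ℂ τ hτ (fourierBasis n) : L2) x) _ = _
  rw [hx1, hx2, RCLike.inner_apply, Function.comp_apply, fourier_neg]

theorem norm_repr_transferL2_fourierBasis_le {τ : UnitAddCircle → UnitAddCircle}
    (hτ : MeasurePreserving τ m m) (n k : ℤ) :
    ‖fourierBasis.repr (transferL2 τ hτ (fourierBasis k)) n‖ ≤ 1 := by
  rw [repr_transferL2_fourierBasis]
  refine (norm_integral_le_of_norm_le_const (C := 1) (.of_forall fun x => ?_)).trans (by simp)
  simp only [norm_mul, fourier_eq_circleChar_zpow, norm_zpow, norm_circleChar, one_zpow, mul_one,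
    le_refl]

/-- The transfer operator of an inner function fixing `0` is bounded on `k_b`. -/
theorem IsInner.exists_transfer {φ : ℂ → ℂ} (hφ : IsInner φ) (hφ0 : φ 0 = 0)
    (b : ℝ) [hb : Fact (1 < b)] :
    ∃ T : KSpace b →L[ℂ] KSpace b, ∀ f : KSpace b,
      IsTransfer m (restriction φ) (KSpace.toL2 f) (KSpace.toL2 (T f)) := by
  obtain ⟨τ, hτ, hφτ⟩ := hφ.exists_measurePreserving hφ0
  have hb1 := KSpace.one_lt_sqrt b
  have hzero (n : ℕ) (k : ℤ) (hk : k < n) : ∫ x, fourier (-k) x * fourier n (τ x) ∂m = 0 := by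
    rw [← hφ.integral_fourier_mul_fourier_restriction hφ0 hk]
    refine integral_congr_ae ?_
    filter_upwards [hφτ] with x hx
    rw [hx]
  obtain ⟨T, hT⟩ := KSpace.exists_clm_of_convolution_bound (b := b) (transferL2 τ hτ)
    (summable_inv_pow_natAbs hb1) (fun n k => by
      -- The condition says that `n` lies between `0` and `k`. Otherwise `k < n` with `n ≥ 0`, or
      -- the mirror image, and the entry vanishes.
      by_cases hnk : n.natAbs + (n - k).natAbs ≤ k.natAbs
      · have h1 := norm_repr_transferL2_fourierBasis_le hτ n k
        rw [inv_mul_eq_div, le_div_iff₀ (by positivity)]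
        calc _ ≤ √b ^ n.natAbs * 1 * √b ^ (n - k).natAbs := by gcongr
          _ = √b ^ (n.natAbs + (n - k).natAbs) := by rw [mul_one, pow_add]
          _ ≤ _ := pow_le_pow_right₀ hb1.le hnk
      · have h0 : fourierBasis.repr (transferL2 τ hτ (fourierBasis k)) n = 0 := by
          rw [repr_transferL2_fourierBasis]
          obtain hn | hn := le_total 0 n
          · lift n to ℕ using hn
            have := congrArg (starRingEnd ℂ) (hzero n k (by omega))
            rw [← integral_conj, map_zero] at this
            simpa only [map_mul, fourier_neg, Complex.conj_conj] using this
          · obtain ⟨j, rfl⟩ : ∃ j : ℕ, n = -j := ⟨n.natAbs, by omega⟩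
            simpa using hzero j (-k) (by omega)
        rw [h0, norm_zero, mul_zero]
        positivity)
  refine ⟨T, fun f => ⟨(Lp.memLp _).integrable one_le_two, (Lp.memLp _).integrable one_le_two,
    fun A hA => ?_⟩⟩
  rw [hT, setIntegral_transferL2 hτ _ hA]
  refine setIntegral_congr_set ?_
  filter_upwards [hφτ] with x hx
  exact congrArg (· ∈ A) hx.symm

/-! ### Multiplication by `ψ` on `k_b` -/

theorem memLp_continuousMap_mul (c : C(UnitAddCircle, ℂ)) (f : L2) :
    MemLp (fun x => c x * f x) 2 m :=
  (Lp.memLp f).of_le_mul (c := ‖c‖)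
    ((map_continuous c).aestronglyMeasurable.mul (Lp.aestronglyMeasurable f))
    (.of_forall fun x => by rw [norm_mul]; gcongr; exact c.norm_coe_le_norm x)

/-- Multiplication by a continuous function on `L²`. -/
noncomputable def mulL2 (c : C(UnitAddCircle, ℂ)) : L2 →L[ℂ] L2 :=
  have hc := memLp_continuousMap_mul c
  LinearMap.mkContinuous
    { toFun := fun f => (hc f).toLp
      map_add' := fun f g => by
        ext1
        filter_upwards [(hc (f + g)).coeFn_toLp, (hc f).coeFn_toLp, (hc g).coeFn_toLp,
          Lp.coeFn_add f g, Lp.coeFn_add (hc f).toLp (hc g).toLp] with x h1 h2 h3 h4 h5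
        change ((hc (f + g)).toLp _ : L2) x = ((hc f).toLp _ + (hc g).toLp _ : L2) x
        rw [h1, h5, Pi.add_apply, h2, h3, h4, Pi.add_apply, mul_add]
      map_smul' := fun a f => by
        ext1
        filter_upwards [(hc (a • f)).coeFn_toLp, (hc f).coeFn_toLp,
          Lp.coeFn_smul a f, Lp.coeFn_smul a (hc f).toLp] with x h1 h2 h3 h4
        change ((hc (a • f)).toLp _ : L2) x = (a • (hc f).toLp _ : L2) x
        rw [h1, h4, Pi.smul_apply, h2, h3, Pi.smul_apply, smul_eq_mul, smul_eq_mul, mul_left_comm] }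
    ‖c‖ fun f => Lp.norm_le_mul_norm_of_ae_le_mul (by
      filter_upwards [(hc f).coeFn_toLp] with x hx
      change ‖((hc f).toLp _ : L2) x‖ ≤ _
      rw [hx, norm_mul]
      gcongr
      exact c.norm_coe_le_norm x)

theorem coeFn_mulL2 (c : C(UnitAddCircle, ℂ)) (f : L2) :
    mulL2 c f =ᵐ[m] fun x => c x * f x :=
  (memLp_continuousMap_mul c f).coeFn_toLp

theorem repr_mulL2_fourierBasis (c : C(UnitAddCircle, ℂ)) (n k : ℤ) :
    fourierBasis.repr (mulL2 c (fourierBasis k)) n = fourierCoeff c (n - k) := by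
  rw [fourierBasis_repr, fourierCoeff, fourierCoeff]
  refine integral_congr_ae ?_
  filter_upwards [coeFn_mulL2 c (fourierBasis k), coeFn_fourierLp (T := 1) 2 k] with x h1 h2
  rw [h1, coe_fourierBasis, h2, neg_sub, sub_eq_add_neg, fourier_add]
  simp only [smul_eq_mul]
  ring

/-- The term is the geometric mean of `(b / B) ^ |n|` and `B ^ |n| * |ψ̂(n)|²`, both summable, hence
at most their sum. -/
theorem MemK.summable_sqrt_pow_mul {b B : ℝ} {ψ : UnitAddCircle → ℂ} (hψ : MemK B ψ)
    (hb : 0 < b) (hbB : b < B) : Summable fun n : ℤ => √b ^ n.natAbs * ‖fourierCoeff ψ n‖ := by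
  have hB : 0 < B := hb.trans hbB
  have h1 := summable_inv_pow_natAbs ((one_lt_div hb).2 hbB)
  refine Summable.of_nonneg_of_le (fun n => by positivity) (fun n => ?_) (h1.add hψ.2)
  have h2 : ((B / b) ^ n.natAbs)⁻¹ * (B ^ n.natAbs * ‖fourierCoeff ψ n‖ ^ 2) =
      (√b ^ n.natAbs * ‖fourierCoeff ψ n‖) ^ 2 := by
    rw [mul_pow, ← pow_mul, mul_comm n.natAbs 2, pow_mul, Real.sq_sqrt hb.le, div_pow]
    field_simp
  have h3 : 0 ≤ ((B / b) ^ n.natAbs)⁻¹ := by positivity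
  have h4 : 0 ≤ B ^ n.natAbs * ‖fourierCoeff ψ n‖ ^ 2 := by positivity
  refine abs_le_of_sq_le_sq' ?_ (by positivity) |>.2
  rw [← h2]
  nlinarith [mul_nonneg h3 h4]

/-- The absolutely summable Fourier series converges uniformly, and its sum agrees with `ψ` in `L²`.
-/
theorem MemK.exists_continuousMap {B : ℝ} {ψ : UnitAddCircle → ℂ} (hψ : MemK B ψ)
    (hs : Summable fun n : ℤ => ‖fourierCoeff ψ n‖) :
    ∃ c : C(UnitAddCircle, ℂ), ψ =ᵐ[m] c := by
  have hs' : Summable fun n : ℤ => fourierCoeff ψ n • (fourier n : C(UnitAddCircle, ℂ)) :=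
    .of_norm (by simpa [norm_smul, fourier_norm] using hs)
  refine ⟨∑' n : ℤ, fourierCoeff ψ n • fourier n, ?_⟩
  have h1 := hs'.hasSum.mapL (ContinuousMap.toLp 2 m ℂ)
  have h2 := hasSum_fourier_series_L2 hψ.1.toLp
  simp only [fourierCoeff_congr_ae hψ.1.coeFn_toLp] at h2
  have h3 := h2.unique (by simpa using h1)
  exact hψ.1.coeFn_toLp.symm.trans (h3 ▸ ContinuousMap.coeFn_toLp _ _)

/-- Multiplication by `ψ ∈ k_B` is bounded on `k_b` for `b < B`. -/
theorem MemK.exists_mul {B : ℝ} {ψ : UnitAddCircle → ℂ} (hψ : MemK B ψ)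
    (b : ℝ) [hb : Fact (1 < b)] (hbB : b < B) :
    ∃ M : KSpace b →L[ℂ] KSpace b, ∀ f : KSpace b,
      KSpace.toL2 (M f) =ᵐ[m] fun x => ψ x * KSpace.toL2 f x := by
  have hs := hψ.summable_sqrt_pow_mul (one_pos.trans hb.out) hbB
  have hb1 := KSpace.one_lt_sqrt b
  obtain ⟨c, hc⟩ := hψ.exists_continuousMap (hs.of_nonneg_of_le (fun n => norm_nonneg _) fun n =>
    le_mul_of_one_le_left (norm_nonneg _) (one_le_pow₀ hb1.le))
  obtain ⟨M, hM⟩ := KSpace.exists_clm_of_convolution_bound (b := b) (mulL2 c) hs (fun n k => by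
    rw [repr_mulL2_fourierBasis, fourierCoeff_congr_ae hc, mul_right_comm, ← pow_add]
    gcongr
    · exact hb1.le
    · omega)
  refine ⟨M, fun f => ?_⟩
  rw [hM]
  filter_upwards [coeFn_mulL2 c (KSpace.toL2 f), hc] with x h1 h2
  rw [h1, h2]

/-! ### The exponential of the multiplication operator -/

theorem MeasureTheory.Lp.coeFn_sum_smul {α : Type*} [MeasurableSpace α] {μ : Measure α}
    {p : ENNReal} (a : ℕ → ℂ) (v : ℕ → Lp ℂ p μ) {g : ℕ → α → ℂ} (hv : ∀ i, v i =ᵐ[μ] g i)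
    (N : ℕ) : (∑ i ∈ Finset.range N, a i • v i : Lp ℂ p μ) =ᵐ[μ]
      fun x => ∑ i ∈ Finset.range N, a i * g i x := by
  induction N with
  | zero =>
    simp only [Finset.range_zero, Finset.sum_empty]
    exact Lp.coeFn_zero ℂ p μ
  | succ N ih =>
    simp only [Finset.sum_range_succ]
    filter_upwards [Lp.coeFn_add (∑ i ∈ Finset.range N, a i • v i) (a N • v N),
      Lp.coeFn_smul (a N) (v N), ih, hv N] with x h1 h2 h3 h4
    rw [h1, Pi.add_apply, h3, h2, Pi.smul_apply, h4, smul_eq_mul]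

namespace KSpace

variable {b : ℝ} [hb : Fact (1 < b)] {M : KSpace b →L[ℂ] KSpace b} {ψ : UnitAddCircle → ℂ}

theorem toL2_pow_ae (hM : ∀ f, toL2 (M f) =ᵐ[m] fun x => ψ x * toL2 f x) (n : ℕ) (f : KSpace b) :
    toL2 ((M ^ n) f) =ᵐ[m] fun x => ψ x ^ n * toL2 f x := by
  induction n with
  | zero => simp
  | succ n ih =>
    rw [pow_succ']
    filter_upwards [hM ((M ^ n) f), ih] with x h1 h2
    rw [mul_apply_eq_comp, h1, h2, pow_succ', mul_assoc]

/-- The partial sums of the exponential series converge in `k_b`, so in `L²` and in measure, to the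
left side; they converge pointwise to the right side. Limits in measure are a.e. unique. -/
theorem toL2_exp_ae (hM : ∀ f, toL2 (M f) =ᵐ[m] fun x => ψ x * toL2 f x) (z : ℂ) (f : KSpace b) :
    toL2 (NormedSpace.exp (z • M) f) =ᵐ[m] fun x => Complex.exp (z * ψ x) * toL2 f x := by
  let p (N : ℕ) (x : UnitAddCircle) : ℂ :=
    ∑ i ∈ Finset.range N, ((i.factorial : ℂ)⁻¹ * (z * ψ x) ^ i) * toL2 f x
  let s (N : ℕ) : L2 :=
    ∑ i ∈ Finset.range N, ((i.factorial : ℂ)⁻¹ * z ^ i) • toL2 ((M ^ i) f)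
  have hsp (N : ℕ) : s N =ᵐ[m] p N := by
    refine (Lp.coeFn_sum_smul _ _ (fun i => toL2_pow_ae hM i f) N).trans (.of_eq ?_)
    ext x
    refine Finset.sum_congr rfl fun i _ => ?_
    rw [mul_pow]
    ring
  have hs : Tendsto s atTop (𝓝 (toL2 (NormedSpace.exp (z • M) f))) := by
    have h := (NormedSpace.exp_series_hasSum_exp' (𝕂 := ℂ) (z • M)).tendsto_sum_nat
    have h' := (continuous_toL2.tendsto _).comp
      (((ContinuousLinearMap.apply ℂ (KSpace b) f).continuous.tendsto _).comp h)
    refine h'.congr fun N => ?_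
    simp [s, smul_pow, smul_smul]
  have hp : ∀ x, Tendsto (fun N => p N x) atTop (𝓝 (Complex.exp (z * ψ x) * toL2 f x)) := by
    intro x
    have h := (NormedSpace.exp_series_hasSum_exp' (𝕂 := ℂ) (z * ψ x)).tendsto_sum_nat
    rw [← Complex.exp_eq_exp_ℂ] at h
    refine (h.mul_const _).congr fun N => ?_
    simp [p, Finset.sum_mul]
  have hpm (N : ℕ) : AEStronglyMeasurable (p N) m := (Lp.aestronglyMeasurable (s N)).congr (hsp N)
  exact tendstoInMeasure_ae_unique
    ((tendstoInMeasure_of_tendsto_Lp hs).congr_left hsp)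
    (tendstoInMeasure_of_tendsto_ae hpm (.of_forall hp))

end KSpace

/-! ### Derivatives in `z` and the theorem -/

theorem hasDerivAt_mul_exp_smul_mul {𝔸 : Type*} [NormedRing 𝔸] [NormedAlgebra ℂ 𝔸]
    [CompleteSpace 𝔸] (T M : 𝔸) (n : ℕ) (z : ℂ) :
    HasDerivAt (fun z : ℂ => T * NormedSpace.exp (z • M) * M ^ n)
      (T * NormedSpace.exp (z • M) * M ^ (n + 1)) z := by
  have h := ((hasDerivAt_exp_smul_const M z).const_mul T).mul_const (M ^ n)
  rwa [mul_assoc T, mul_assoc _ M, ← pow_succ', ← mul_assoc] at h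

theorem iteratedDeriv_mul_exp_smul {𝔸 : Type*} [NormedRing 𝔸] [NormedAlgebra ℂ 𝔸]
    [CompleteSpace 𝔸] (T M : 𝔸) (n : ℕ) :
    iteratedDeriv n (fun z : ℂ => T * NormedSpace.exp (z • M)) =
      fun z => T * NormedSpace.exp (z • M) * M ^ n := by
  induction n with
  | zero => simp
  | succ n ih =>
    rw [iteratedDeriv_succ, ih]
    exact funext fun z => (hasDerivAt_mul_exp_smul_mul T M n z).deriv

theorem theorem4p1 (φ : ℂ → ℂ) (hφ : IsInner φ) (hφM : ¬ IsMoebius φ) (hφ0 : φ 0 = 0)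
    (B : ℝ) (hB : 1 < B) (ψ : UnitAddCircle → ℂ) (hψ : MemK B ψ)
    (b : ℝ) [hb : Fact (1 < b)] (hbB : b < B) :
    ∃ P : ℂ → (KSpace b →L[ℂ] KSpace b),
      (∀ (z : ℂ) (f : KSpace b),
        IsTransfer AddCircle.haarAddCircle (restriction φ)
          (fun x => Complex.exp (z * ψ x) * KSpace.toL2 f x) (KSpace.toL2 (P z f))) ∧
      Differentiable ℂ P ∧
      ∀ (n : ℕ) (z : ℂ) (f : KSpace b), ∃ g : KSpace b,
        (KSpace.toL2 g : UnitAddCircle → ℂ) =ᵐ[AddCircle.haarAddCircle]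
          (fun x => ψ x ^ n * KSpace.toL2 f x) ∧
        iteratedDeriv n P z f = P z g := by
  obtain ⟨T, hT⟩ := hφ.exists_transfer hφ0 b
  obtain ⟨M, hM⟩ := hψ.exists_mul b hbB
  refine ⟨fun z => T * NormedSpace.exp (z • M), fun z f => ?_, fun z => ?_, fun n z f =>
    ⟨(M ^ n) f, KSpace.toL2_pow_ae hM n f, ?_⟩⟩
  · have h := hT (NormedSpace.exp (z • M) f)
    have hae := KSpace.toL2_exp_ae hM z f
    refine ⟨h.integrable.congr hae, h.integrable_transfer, fun A hA => ?_⟩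
    exact (h.setIntegral_eq A hA).trans (integral_congr_ae (ae_restrict_of_ae hae))
  · simpa using (hasDerivAt_mul_exp_smul_mul T M 0 z).differentiableAt
  · exact DFunLike.congr_fun (congrFun (iteratedDeriv_mul_exp_smul T M n) z) f
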